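/- Call a topological space $X$ \emph{locally strongly sober} if, for every convergent ultrafilter $\mathcal U$ on $X$ (that is, one with at least one limit), the set $\lim\mathcal U$ of all limits of $\mathcal U$ is the closure $\overline{\{x\}}$ of a unique point $x\in X$. Call $X$ \emph{strongly sober} if the same holds for every ultrafilter $\mathcal U$ on $X$. No separation axiom is assumed. A \emph{projective system} of topological spaces consists of spaces $X_i$ indexed by a non-empty directed preordered set $(I,\sqsubseteq)$ and continuous maps $p_{ij}\colon X_j\to X_i$ for all $i\sqsubseteq j$ in $I$, with $p_{ii}=\mathrm{id}_{X_i}$ and $p_{ij}\circ p_{jk}=p_{ik}$ for all $i\sqsubseteq j\sqsubseteq k$. A \emph{projective limit} is any limit (universal cone) of such a system in the category of topological spaces and continuous maps; up to homeomorphism, it is the space $\{\vec x\in\prod_{i\in I}X_i\mid \forall i\sqsubseteq j,\ p_{ij}(x_j)=x_i\}$ with the subspace topology of the product. A class of topological spaces is \emph{projective} if, for every projective system of spaces in the class, every projective limit of it is in the class. \textbf{Theorem.} The class of locally strongly sober spaces is projective, and so is the class of strongly sober spaces. -/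

import Mathlib

open CategoryTheory CategoryTheory.Limits Topology

universe u w

/-- The set of limits of an ultrafilter `U` on a topological space `X`. -/
def ultrafilterLimits {X : Type*} [TopologicalSpace X] (U : Ultrafilter X) : Set X :=
  {x | (U : Filter X) ≤ 𝓝 x}

/-- `X` is locally strongly sober if the set of limits of every convergent ultrafilter on `X`
is the closure of a unique point. -/
def IsLocallyStronglySober (X : Type*) [TopologicalSpace X] : Prop :=
  ∀ U : Ultrafilter X, (ultrafilterLimits U).Nonempty →
    ∃! x : X, ultrafilterLimits U = closure {x}

/-- `X` is strongly sober if the set of limits of every ultrafilter on `X` is the closure of a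
unique point. -/
def IsStronglySober (X : Type*) [TopologicalSpace X] : Prop :=
  ∀ U : Ultrafilter X, ∃! x : X, ultrafilterLimits U = closure {x}

/-- A class `P` of topological spaces is projective if it is closed under projective limits:
for every projective system `F` of spaces in `P`, indexed by a non-empty directed preordered set
`I` (a continuous bonding map `F j ⟶ F i` whenever `i ≤ j`, hence a functor on `Iᵒᵖ`), and every
limit cone `c` of `F` in the category of topological spaces, the space `c.pt` is in `P`. -/
def IsProjectiveClass (P : ObjectProperty TopCat.{w}) : Prop :=
  ∀ (I : Type u) [Preorder I] [IsDirectedOrder I] [Nonempty I]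
    (F : Iᵒᵖ ⥤ TopCat.{w}) (c : Cone F),
    Nonempty (IsLimit c) → (∀ i : Iᵒᵖ, P (F.obj i)) → P c.pt

/-! Order each space by `a ≤ b` iff `b ⤳ a`, so that `closure {x}` is the down-set of `x`. If `y i`
generates the limit set of the image of `U` in the `i`-th space, continuity gives only `p (y j) ≤ y
i`, and the limits of `U` are the compatible families below `y`. A largest one is needed. Zorn's
lemma yields a minimal lax family between all these limits and `y`; minimality makes it compatible,
hence itself a limit. The infima required exist because the lower bounds of a filtered set are the
limits of an ultrafilter. -/

/-- Let `p` be a projective system of monotone maps between partial orders and let `y` be a family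
with `p (y j) ≤ y i`. If, in each `P i`, every filtered set that lies above the `i`-th components
of all members of `L` has a greatest lower bound, then there is a compatible family between `L`
and `y`. -/
theorem exists_compatible_le_of_lax {I : Type*} [Preorder I] [IsDirectedOrder I]
    {P : I → Type*} [∀ i, PartialOrder (P i)]
    (p : ∀ {i j : I}, i ≤ j → P j → P i)
    (p_mono : ∀ {i j : I} (h : i ≤ j), Monotone (p h))
    (p_id : ∀ (i : I) (x : P i), p (le_refl i) x = x)
    (p_comp : ∀ {i j k : I} (hij : i ≤ j) (hjk : j ≤ k) (x : P k),
      p hij (p hjk x) = p (hij.trans hjk) x)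
    (y : ∀ i, P i) (hy : ∀ {i j : I} (h : i ≤ j), p h (y j) ≤ y i)
    (L : Set (∀ i, P i)) (hL : ∀ x ∈ L, x ≤ y)
    (hLp : ∀ x ∈ L, ∀ {i j : I} (h : i ≤ j), p h (x j) = x i)
    (glb : ∀ (i : I) (D : Set (P i)), D.Nonempty → DirectedOn (· ≥ ·) D →
      (∀ x ∈ L, x i ∈ lowerBounds D) → ∃ z, IsGLB D z) :
    ∃ w : ∀ i, P i, (∀ {i j : I} (h : i ≤ j), p h (w j) = w i) ∧ w ≤ y ∧ ∀ x ∈ L, x ≤ w := by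
  -- The dual order turns Zorn's maximal element into a minimal lax family.
  let S : Set (∀ i, P i)ᵒᵈ :=
    {w | (∀ i j (h : i ≤ j), p h (OrderDual.ofDual w j) ≤ OrderDual.ofDual w i) ∧
      OrderDual.ofDual w ≤ y ∧ ∀ x ∈ L, x ≤ OrderDual.ofDual w}
  have hyS : OrderDual.toDual y ∈ S := ⟨fun i j h => hy h, le_refl y, hL⟩
  obtain ⟨m, -, hm⟩ := zorn_le_nonempty₀ S (by
    intro c hcS hc a ha
    have hglb : ∀ i, ∃ z, IsGLB ((fun w : (∀ i, P i)ᵒᵈ => OrderDual.ofDual w i) '' c) z := by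
      intro i
      refine glb i _ ⟨_, a, ha, rfl⟩ ?_ ?_
      · rintro _ ⟨b, hb, rfl⟩ _ ⟨d, hd, rfl⟩
        rcases hc.total hb hd with h | h
        · exact ⟨_, ⟨d, hd, rfl⟩, h i, le_rfl⟩
        · exact ⟨_, ⟨b, hb, rfl⟩, le_rfl, h i⟩
      · rintro x hx _ ⟨b, hb, rfl⟩
        exact (hcS hb).2.2 x hx i
    choose g hg using hglb
    refine ⟨OrderDual.toDual g, ⟨fun i j h => ?_, fun i => ?_, fun x hx i => ?_⟩, fun b hb i => ?_⟩
    · refine (hg i).2 ?_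
      rintro _ ⟨b, hb, rfl⟩
      exact (p_mono h ((hg j).1 ⟨b, hb, rfl⟩)).trans ((hcS hb).1 i j h)
    · exact ((hg i).1 ⟨a, ha, rfl⟩).trans ((hcS ha).2.1 i)
    · refine (hg i).2 ?_
      rintro _ ⟨b, hb, rfl⟩
      exact (hcS hb).2.2 x hx i
    · exact (hg i).1 ⟨b, hb, rfl⟩) _ hyS
  obtain ⟨w, rfl⟩ := OrderDual.toDual.surjective m
  obtain ⟨hw, hwy, hLw⟩ : (∀ i j (h : i ≤ j), p h (w j) ≤ w i) ∧ w ≤ y ∧ ∀ x ∈ L, x ≤ w := hm.prop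
  have anti : ∀ {i j k : I} (hij : i ≤ j) (hjk : j ≤ k),
      p (hij.trans hjk) (w k) ≤ p hij (w j) := fun hij hjk => by
    rw [← p_comp hij hjk]
    exact p_mono hij (hw _ _ hjk)
  have hglb : ∀ i, ∃ z, IsGLB {v | ∃ (j : I) (h : i ≤ j), p h (w j) = v} z := by
    intro i
    refine glb i _ ⟨_, i, le_rfl, rfl⟩ ?_ ?_
    · rintro _ ⟨j, hj, rfl⟩ _ ⟨k, hk, rfl⟩
      obtain ⟨l, hjl, hkl⟩ := exists_ge_ge j k
      exact ⟨_, ⟨l, hj.trans hjl, rfl⟩, anti hj hjl, anti hk hkl⟩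
    · rintro x hx _ ⟨j, hj, rfl⟩
      rw [← hLp x hx hj]
      exact p_mono hj (hLw x hx j)
  -- `z i` is the infimum of all `p (w j)` with `j ≥ i`. It is again lax, so minimality of `w` gives
  -- `w i ≤ p (w j)`.
  choose z hz using hglb
  have hzw : z ≤ w := fun i => (hz i).1 ⟨i, le_rfl, p_id i _⟩
  have hzS : OrderDual.toDual z ∈ S := by
    refine ⟨fun i j h => (hz i).2 ?_, hzw.trans hwy, fun x hx i => (hz i).2 ?_⟩
    · rintro _ ⟨k, hk, rfl⟩
      obtain ⟨l, hjl, hkl⟩ := exists_ge_ge j k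
      refine (p_mono h ((hz j).1 ⟨l, hjl, rfl⟩)).trans ?_
      rw [p_comp h hjl]
      exact anti hk hkl
    · rintro _ ⟨j, hj, rfl⟩
      rw [← hLp x hx hj]
      exact p_mono hj (hLw x hx j)
  have hwz : w ≤ z := hm.le_of_ge hzS hzw
  exact ⟨w, fun {i j} h => (hw i j h).antisymm ((hwz i).trans ((hz i).1 ⟨j, h, rfl⟩)), hwy, hLw⟩

section Topology

variable {X : Type*} [TopologicalSpace X]

theorem ultrafilterLimits_pure (x : X) :
    ultrafilterLimits (pure x : Ultrafilter X) = closure {x} := by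
  ext z
  rw [← specializes_iff_mem_closure, specializes_iff_pure]
  rfl

/-- Inseparable points generate the same closure, the limit set of a principal ultrafilter, whose
generator is unique. -/
theorem IsLocallyStronglySober.t0Space (hX : IsLocallyStronglySober X) : T0Space X := by
  refine ⟨fun x y hxy => ?_⟩
  have hx := ultrafilterLimits_pure x
  refine (hX (pure x) ⟨x, ?_⟩).unique hx (hx.trans (inseparable_iff_closure_eq.1 hxy))
  rw [hx]
  exact subset_closure rfl

theorem IsStronglySober.isLocallyStronglySober (hX : IsStronglySober X) :
    IsLocallyStronglySober X := fun U _ => hX U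

/-- The lower bounds, in the specialization preorder, of a filtered set are the limits of some
ultrafilter. -/
theorem exists_ultrafilterLimits_eq_lowerBounds {D : Set X} (hne : D.Nonempty)
    (hD : DirectedOn (fun a b : X => a ⤳ b) D) :
    ∃ W : Ultrafilter X, ultrafilterLimits W = {x | ∀ d ∈ D, d ⤳ x} := by
  have := hne.to_subtype
  let f : D → Filter X := fun d => Filter.principal (D ∩ closure {d.1})
  have hf : Directed (· ≥ ·) f := by
    rintro ⟨a, ha⟩ ⟨b, hb⟩
    obtain ⟨d, hd, had, hbd⟩ := hD a ha b hb
    exact ⟨⟨d, hd⟩,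
      Filter.principal_mono.2 (Set.inter_subset_inter_right _ had.closure_subset),
      Filter.principal_mono.2 (Set.inter_subset_inter_right _ hbd.closure_subset)⟩
  -- Any ultrafilter containing all tails `D ∩ closure {d}` works.
  have : (⨅ d, f d).NeBot := Filter.iInf_neBot_of_directed' hf fun d =>
    Filter.principal_neBot_iff.2 ⟨d, d.2, subset_closure rfl⟩
  have hW (d : D) : D ∩ closure {d.1} ∈ Ultrafilter.of (⨅ d, f d) :=
    (Ultrafilter.of_le _).trans (iInf_le f d) (Filter.mem_principal_self _)
  refine ⟨Ultrafilter.of (⨅ d, f d), Set.ext fun x => ⟨fun hx d hd => ?_, fun hx => ?_⟩⟩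
  · rw [specializes_iff_mem_closure]
    refine isClosed_closure.mem_of_frequently_of_tendsto (b := (Ultrafilter.of (⨅ d, f d) :
      Filter X)) (f := id) ?_ hx
    exact Filter.Eventually.frequently (Filter.mem_of_superset (hW ⟨d, hd⟩) Set.inter_subset_right)
  · intro s hs
    exact Filter.mem_of_superset (hW ⟨_, hne.some_mem⟩)
      fun d hd => mem_of_mem_nhds (hx d hd.1 hs)

theorem mem_ultrafilterLimits_of_specializes {U : Ultrafilter X} {x z : X}
    (hx : x ∈ ultrafilterLimits U) (h : x ⤳ z) : z ∈ ultrafilterLimits U :=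
  le_trans (show (U : Filter X) ≤ 𝓝 x from hx) h

end Topology

section Limit

variable {J : Type*} [Category* J] {F : J ⥤ TopCat.{w}} {c : Cone F}

theorem TopCat.le_nhds_iff_of_isLimit (hc : IsLimit c) (l : Filter c.pt) (x : c.pt) :
    l ≤ 𝓝 x ↔ ∀ j, l.map (c.π.app j) ≤ 𝓝 (c.π.app j x) := by
  have h : 𝓝 x = ⨅ j, (𝓝 (c.π.app j x)).comap (c.π.app j) := by
    rw [congrArg (fun t => @nhds _ t x) (TopCat.induced_of_isLimit c hc), nhds_iInf]
    exact iInf_congr fun j => nhds_induced _ x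
  rw [h, le_iInf_iff]
  exact forall_congr' fun j => Filter.map_le_iff_le_comap.symm

theorem TopCat.specializes_iff_of_isLimit (hc : IsLimit c) (x y : c.pt) :
    x ⤳ y ↔ ∀ j, c.π.app j x ⤳ c.π.app j y := by
  simp only [specializes_iff_pure, ← Filter.map_pure]
  exact TopCat.le_nhds_iff_of_isLimit hc (pure x) y

theorem TopCat.eq_of_isLimit (hc : IsLimit c) {x y : c.pt}
    (h : ∀ j, c.π.app j x = c.π.app j y) : x = y :=
  Types.isLimitEquivSections (isLimitOfPreserves (forget TopCat) hc) |>.injective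
    (Subtype.ext (funext h))

theorem TopCat.exists_of_isLimit (hc : IsLimit c) (w : ∀ j, F.obj j)
    (hw : ∀ {i j : J} (f : i ⟶ j), F.map f (w i) = w j) :
    ∃ x : c.pt, ∀ j, c.π.app j x = w j := by
  let e := Types.isLimitEquivSections (isLimitOfPreserves (forget TopCat) hc)
  let s : (F ⋙ forget TopCat).sections := ⟨w, fun f => hw f⟩
  exact ⟨e.symm s, fun j => congrFun (congrArg Subtype.val (e.apply_symm_apply s)) j⟩

theorem TopCat.t0Space_of_isLimit (hc : IsLimit c) [∀ j, T0Space (F.obj j)] : T0Space c.pt :=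
  ⟨fun _ _ h => TopCat.eq_of_isLimit hc fun j => (h.map (c.π.app j).hom.continuous).eq⟩

end Limit

/-- In a projective limit of `T₀` spaces, the limit set of an ultrafilter `U` is the closure of a
unique point as soon as this holds, on each space of the system, for the ultrafilters that converge
to the projections of all limits of `U`. -/
theorem existsUnique_ultrafilterLimits_eq_closure {I : Type*} [Preorder I] [IsDirectedOrder I]
    {F : Iᵒᵖ ⥤ TopCat.{w}} {c : Cone F} (hc : IsLimit c) [∀ i, T0Space (F.obj i)]
    (U : Ultrafilter c.pt)
    (h : ∀ i (W : Ultrafilter (F.obj i)),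
      (∀ x ∈ ultrafilterLimits U, c.π.app i x ∈ ultrafilterLimits W) →
        ∃ y, ultrafilterLimits W = closure {y}) :
    ∃! x : c.pt, ultrafilterLimits U = closure {x} := by
  have := TopCat.t0Space_of_isLimit hc
  have mem_iff (x : c.pt) : x ∈ ultrafilterLimits U ↔
      ∀ i, c.π.app i x ∈ ultrafilterLimits (U.map (c.π.app i)) :=
    TopCat.le_nhds_iff_of_isLimit hc U x
  choose y hy using fun i => h i (U.map (c.π.app i)) fun x hx => (mem_iff x).1 hx i
  have mem_iff' (x : c.pt) : x ∈ ultrafilterLimits U ↔ ∀ i, y i ⤳ c.π.app i x := by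
    simp only [mem_iff, hy, specializes_iff_mem_closure]
  let _ : ∀ i : I, PartialOrder (F.obj (.op i)) := fun i => specializationOrder _
  have p_y {i j : I} (hij : i ≤ j) : y (.op i) ⤳ F.map (homOfLE hij).op (y (.op j)) := by
    rw [specializes_iff_mem_closure, ← hy]
    have hyj : y (.op j) ∈ ultrafilterLimits (U.map (c.π.app (.op j))) := by
      rw [hy]
      exact subset_closure rfl
    have hlim := ((F.map (homOfLE hij).op).hom.continuous.tendsto (y (.op j))).mono_left hyj
    have hmap : (c.π.app (.op i) : c.pt → F.obj (.op i)) =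
        F.map (homOfLE hij).op ∘ c.π.app (.op j) :=
      funext fun x => (ConcreteCategory.congr_hom (c.w (homOfLE hij).op) x).symm
    rw [hmap]
    exact hlim
  obtain ⟨w, hw, hwy, hLw⟩ := exists_compatible_le_of_lax (P := fun i : I => F.obj (.op i))
    (fun {i j} hij => F.map (homOfLE hij).op)
    (fun {i j} hij a b hab => Specializes.map hab (F.map (homOfLE hij).op).hom.continuous)
    (fun i x => by simp)
    (fun {i j k} hij hjk x => by
      rw [← ConcreteCategory.comp_apply, ← F.map_comp]
      rfl)
    (fun i => y (.op i)) p_y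
    ((fun x i => c.π.app (.op i) x) '' ultrafilterLimits U)
    (by
      rintro _ ⟨x, hx, rfl⟩ i
      exact (mem_iff' x).1 hx (.op i))
    (by
      rintro _ ⟨x, hx, rfl⟩ i j hij
      exact ConcreteCategory.congr_hom (c.w (homOfLE hij).op) x)
    (by
      intro i D hne hD hlb
      -- The generator of the limit set of `W` is the infimum of `D`.
      obtain ⟨W, hW⟩ := exists_ultrafilterLimits_eq_lowerBounds hne fun a ha b hb =>
        let ⟨d, hd, hda, hdb⟩ := hD a ha b hb
        ⟨d, hd, hda, hdb⟩
      obtain ⟨z, hz⟩ := h (.op i) W fun x hx => by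
        rw [hW]
        exact fun d hd => hlb _ ⟨x, hx, rfl⟩ hd
      have key (v : F.obj (.op i)) : (∀ d ∈ D, d ⤳ v) ↔ z ⤳ v := by
        rw [specializes_iff_mem_closure, ← hz, hW]
        rfl
      exact ⟨z, fun d hd => (key z).2 specializes_rfl d hd,
        fun v hv => (key v).1 fun d hd => hv hd⟩)
  obtain ⟨x, hx⟩ := TopCat.exists_of_isLimit hc (fun i => w i.unop) fun {i j} f =>
    hw (leOfHom f.unop)
  have hxU : ultrafilterLimits U = closure {x} := by
    ext v
    rw [← specializes_iff_mem_closure]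
    refine ⟨fun hv => (TopCat.specializes_iff_of_isLimit hc x v).2 fun i => ?_,
      mem_ultrafilterLimits_of_specializes ((mem_iff' x).2 fun i => ?_)⟩
    · rw [hx]
      exact hLw _ ⟨v, hv, rfl⟩ i.unop
    · rw [hx]
      exact hwy i.unop
  exact ⟨x, hxU, fun v hv => (inseparable_iff_closure_eq.2 (hv.symm.trans hxU)).eq⟩

theorem mainTheorem2 :
    IsProjectiveClass.{u, w} (fun X : TopCat.{w} => IsLocallyStronglySober X) ∧
      IsProjectiveClass.{u, w} (fun X : TopCat.{w} => IsStronglySober X) := by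
  constructor
  · intro I _ _ _ F c ⟨hc⟩ hF U ⟨x, hx⟩
    have : ∀ i, T0Space (F.obj i) := fun i => (hF i).t0Space
    -- The projection of the limit `x` makes `W` convergent.
    exact existsUnique_ultrafilterLimits_eq_closure hc U fun i W hW =>
      (hF i W ⟨_, hW x hx⟩).exists
  · intro I _ _ _ F c ⟨hc⟩ hF U
    have : ∀ i, T0Space (F.obj i) := fun i => (hF i).isLocallyStronglySober.t0Space
    exact existsUnique_ultrafilterLimits_eq_closure hc U fun i W _ => (hF i W).exists
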